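/- **Setting.** Let $0<h\le T$, let $X\subseteq\mathbb R^n$ be a Borel set, $X_0\subseteq X$, and let $p:\mathbb R^n\to\mathbb R$ be a Borel function that is bounded on $X$; put $p_{\min}=\inf_X p$, $p_{\max}=\sup_X p$. Let $\epsilon\in[0,1)$. Time is either continuous, with time domain $[0,T]$, $\mathrm d\kappa=\mathrm dt$ and $\delta=0$, or discrete with step $\Delta t>0$, with time domain $\{k\Delta t: k\in\mathbb N\}\cap[0,T]$, $\kappa=\Delta t\sum_{k\in\mathbb N}\delta_{k\Delta t}$ and $\delta=\Delta t$, where $h$ is an integer multiple of $\Delta t$. A generator $\mathcal L$ is a linear operator with domain $\mathcal C$, a linear space of Borel functions $w(t,x)$, such that $w$ and $\mathcal Lw$ are Borel, and bounded on $[0,T]\times X$, for every $w\in\mathcal C$. **Time-windowed risk problem.** A feasible point consists of a (deterministic) time $t^*\in[h,T]$ of the time domain, a state $x_0\in X_0$, and a jointly measurable process $x(t)$ on a probability space with $x(0)=x_0$, such that up to time $t^*$: $x(t)\in X$; (A3) trajectories stop according to the rule $\min(T,\tau_X)$, i.e. almost surely $x(t)=x(r)$ whenever $r\le t\le t^*$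 and $x(r)\in\partial X$; and $x$ (stopped by this rule) follows $\mathcal L$, i.e. there is a filtration to which $x$ is adapted and for which $$w(t,x(t))-\int_{[0,t)}\mathcal Lw(r,x(r))\,\mathrm d\kappa(r),\qquad t\le t^*,$$ is a martingale for every $w\in\mathcal C$. Let $\xi$ be the distribution of the values of $p$ along the window, i.e. the image of $\frac1h\,\kappa|_{[t^*-h,t^*)}\otimes\mathbb P$ under $(t,\omega)\mapsto p(x(t,\omega))$, and let $$\mathrm{ES}_\epsilon(\xi)=\inf_{\lambda\in\mathbb R}\Big\{\lambda+\tfrac1\epsilon\int(q-\lambda)_+\,\mathrm d\xi(q)\Big\}$$ (for $\epsilon=0$, with $\tfrac10=\infty$ and $\infty\cdot0=0$, this is the essential supremum). $P^*$ is the supremum of $\mathrm{ES}_\epsilon(\xi)$ over all feasible points. **Measure program.** Let $\Omega_+=\{(s,t)\in[h,T]\times[0,T]: s-h\le t\le s\}$, $\Omega_-=\{(s,t)\in[h,T]\times[0,T]: 0\le t\le s-h-\delta\}$, and $\hat{\mathcal L}v(s,t,x)=(\mathcal Lv(s,\cdot,\cdot))(t,x)$, for Borel $v(s,t,x)$ with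 $v(s,\cdot,\cdot)\in\mathcal C$ for all $s\in[h,T]$, $\hat{\mathcal L}v$ Borel, and $v,\hat{\mathcal L}v$ bounded on $[h,T]\times[0,T]\times X$. Then $p^*_{ES}$ is the supremum of $\int q\,\mathrm d\nu(q)$ over all finite nonnegative Borel measures $\mu_0$ on $[h,T]\times X_0$, $\mu_\tau$ on $[h,T]\times X$, $\mu_\pm$ on $\Omega_\pm\times X$, and $\nu,\hat\nu$ on $[p_{\min},p_{\max}]$, such that $$\int v(s,s,x)\,\mathrm d\mu_\tau=\int v(s,0,x)\,\mathrm d\mu_0+\int\hat{\mathcal L}v\,\mathrm d(\mu_-+\mu_+)\quad\text{for all such }v,$$ $$\langle1,\mu_0\rangle=1,\qquad\langle1,\mu_+\rangle=h,\qquad\langle1,\nu\rangle=1,\qquad\epsilon\nu+\hat\nu=p_\#\pi^x_\#(\mu_+/h).$$ Suprema are taken in $[-\infty,\infty]$. **Theorem.** $p^*_{ES}\ge P^*$. Moreover, every feasible point $(t^*,x_0,x)$ of the risk problem gives a feasible point of the measure program in which $\mu_+$ is the windowed occupation measure, i.e. the image of $\kappa|_{[t^*-h,t^*)}\otimes\mathbb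 P$ under $(t,\omega)\mapsto(t^*,t,x(t,\omega))$, and in which $\nu$ (the normalised top-$\epsilon$ mass of $\xi$) satisfies $\int q\,\mathrm d\nu(q)=\mathrm{ES}_\epsilon(\xi)$. -/

import Mathlib

open MeasureTheory ProbabilityTheory Set
open scoped ENNReal

noncomputable section

namespace TimeWindowRisk

/-- The ambient Euclidean space of the states. -/
abbrev State (n : ℕ) : Type := EuclideanSpace ℝ (Fin n)

/-- Continuous time, or discrete time with a positive increment `dt`. -/
inductive TimeModel : Type
  | continuous : TimeModel
  | discrete (dt : ℝ) (dt_pos : 0 < dt) : TimeModel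

namespace TimeModel

/-- The time domain up to the horizon `T`: the interval `[0, T]`, or the grid points
`0, dt, 2 dt, …` that are at most `T`. -/
def times : TimeModel → ℝ → Set ℝ
  | continuous, T => Icc 0 T
  | discrete dt _, T => {t | ∃ k : ℕ, t = k * dt ∧ t ≤ T}

/-- The measure against which time integrals are taken: Lebesgue measure, or mass `dt` at each
grid point. -/
def clock : TimeModel → Measure ℝ
  | continuous => volume
  | discrete dt _ =>
      ENNReal.ofReal dt • Measure.sum (fun k : ℕ => Measure.dirac ((k : ℝ) * dt))

/-- The gap between the past and the window: zero, or one time step. -/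
def gap : TimeModel → ℝ
  | continuous => 0
  | discrete dt _ => dt

/-- In discrete time the window length is a whole number of steps. -/
def Compatible : TimeModel → ℝ → Prop
  | continuous, _ => True
  | discrete dt _, h => ∃ m : ℕ, h = m * dt

end TimeModel

/-- A generator `L` on `[0, T] × X`: a linear operator whose domain is a linear space of functions
of `(t, x)`. Functions in the domain and in the image are Borel, and bounded on `[0, T] × X`, so
that their pairings with finite measures on `[0, T] × X` are defined. -/
structure Generator {n : ℕ} (T : ℝ) (X : Set (State n)) where
  op : (ℝ × State n → ℝ) →ₗ.[ℝ] (ℝ × State n → ℝ)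
  measurable_dom : ∀ w : op.domain, Measurable (w : ℝ × State n → ℝ)
  bounded_dom : ∀ w : op.domain, ∃ M : ℝ,
    ∀ z ∈ Icc 0 T ×ˢ X, |(w : ℝ × State n → ℝ) z| ≤ M
  measurable_op : ∀ w : op.domain, Measurable (op w)
  bounded_op : ∀ w : op.domain, ∃ M : ℝ, ∀ z ∈ Icc 0 T ×ˢ X, |op w z| ≤ M

namespace Generator

variable {n : ℕ} {T : ℝ} {X : Set (State n)}

open Classical in
/-- `L w`, set to zero when `w` is not in the domain. -/
def app (G : Generator T X) (w : ℝ × State n → ℝ) : ℝ × State n → ℝ :=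
  if hw : w ∈ G.op.domain then G.op ⟨w, hw⟩ else 0

/-- The augmented operator on functions of `(s, t, x)`: `s` is constant along trajectories, hence
`L` acts on `v (s, ·, ·)` for each fixed `s`. -/
def aug (G : Generator T X) (v : ℝ × ℝ × State n → ℝ) : ℝ × ℝ × State n → ℝ :=
  fun z => G.app (fun y => v (z.1, y)) z.2

/-- The domain of the augmented operator: `v (s, ·, ·)` is in the domain of `L` for every
`s ∈ [h, T]`, and `v` and its image are Borel, and bounded on `[h, T] × [0, T] × X`. -/
structure IsTest (G : Generator T X) (h : ℝ) (v : ℝ × ℝ × State n → ℝ) : Prop where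
  slice : ∀ s ∈ Icc h T, (fun y => v (s, y)) ∈ G.op.domain
  measurable : Measurable v
  bounded : ∃ M : ℝ, ∀ z ∈ Icc h T ×ˢ (Icc 0 T ×ˢ X), |v z| ≤ M
  measurable_aug : Measurable (G.aug v)
  bounded_aug : ∃ M : ℝ, ∀ z ∈ Icc h T ×ˢ (Icc 0 T ×ˢ X), |G.aug v z| ≤ M

end Generator

/-- The expected shortfall at level `ε` of a real random variable with distribution `ψ`: the
infimum over `l` of `l + (1 / ε) 𝔼 (V - l)₊`. The factor and the expectation are extended
nonnegative numbers; for `ε = 0` the infimum is the essential supremum, as `∞ * 0 = 0`. -/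
def expectedShortfall (ε : ℝ) (ψ : Measure ℝ) : EReal :=
  ⨅ l : ℝ, (l : EReal) +
    (((ENNReal.ofReal ε)⁻¹ * ∫⁻ q, ENNReal.ofReal (q - l) ∂ψ : ℝ≥0∞) : EReal)

/-- A feasible point of the time-windowed risk problem: a time `tstar ∈ [h, T]` of the time domain,
an initial state `x0 ∈ X₀`, and a process `path` started at `x0` that lives in `X`, stops at its
first contact with the boundary of `X`, and follows `L` up to `tstar`, in the sense of the
martingale problem. Values of `path` at times outside the time domain up to `tstar` are
irrelevant. -/
structure Trajectory {n : ℕ} (τ : TimeModel) (h T : ℝ) {X : Set (State n)} (G : Generator T X)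
    (X₀ : Set (State n)) where
  tstar : ℝ
  tstar_mem_times : tstar ∈ τ.times T
  tstar_mem_Icc : tstar ∈ Icc h T
  x0 : State n
  x0_mem : x0 ∈ X₀
  Ω : Type
  mΩ : MeasurableSpace Ω
  P : Measure Ω
  isProb : IsProbabilityMeasure P
  path : ℝ → Ω → State n
  measurable_path : Measurable (fun z : ℝ × Ω => path z.1 z.2)
  start : ∀ ω, path 0 ω = x0
  mem_state : ∀ t ∈ τ.times tstar, ∀ ω, path t ω ∈ X
  stops : ∀ᵐ ω ∂P, ∀ r ∈ τ.times tstar, ∀ t ∈ τ.times tstar, r ≤ t →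
    path r ω ∈ frontier X → path t ω = path r ω
  ℱ : Filtration (τ.times tstar) mΩ
  adapted : ∀ t : τ.times tstar, Measurable[ℱ t] (path t)
  follows : ∀ w : G.op.domain,
    Martingale (fun (t : τ.times tstar) ω =>
      (w : ℝ × State n → ℝ) ((t : ℝ), path t ω)
        - ∫ r in Ico 0 (t : ℝ), G.op w (r, path r ω) ∂τ.clock) ℱ P

attribute [instance] Trajectory.mΩ Trajectory.isProb

namespace Trajectory

variable {n : ℕ} {τ : TimeModel} {h T : ℝ} {X : Set (State n)} {G : Generator T X}
  {X₀ : Set (State n)}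

/-- The distribution of `p (x t)` over the window `[tstar - h, tstar)`, averaged over time. -/
def windowLaw (A : Trajectory τ h T G X₀) (p : State n → ℝ) : Measure ℝ :=
  ((ENNReal.ofReal h)⁻¹ • (τ.clock.restrict (Ico (A.tstar - h) A.tstar)).prod A.P).map
    (fun z => p (A.path z.1 z.2))

/-- The occupation measure of `(tstar, t, x t)` over the window `[tstar - h, tstar)`. -/
def windowOcc (A : Trajectory τ h T G X₀) : Measure (ℝ × ℝ × State n) :=
  ((τ.clock.restrict (Ico (A.tstar - h) A.tstar)).prod A.P).map
    (fun z => (A.tstar, z.1, A.path z.1 z.2))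

end Trajectory

/-- The optimal value `P*` of the time-windowed risk problem for the expected shortfall. -/
def riskValue {n : ℕ} (τ : TimeModel) (h T : ℝ) {X : Set (State n)} (G : Generator T X)
    (X₀ : Set (State n)) (p : State n → ℝ) (ε : ℝ) : EReal :=
  ⨆ A : Trajectory τ h T G X₀, expectedShortfall ε (A.windowLaw p)

/-- `(s, t, x)` with `(s, t) ∈ [h, T] × [0, T]`, `s - h ≤ t ≤ s` and `x ∈ X`. -/
def windowSupport {n : ℕ} (h T : ℝ) (X : Set (State n)) : Set (ℝ × ℝ × State n) :=
  {z | z.1 ∈ Icc h T ∧ z.2.1 ∈ Icc 0 T ∧ z.2.1 ∈ Icc (z.1 - h) z.1 ∧ z.2.2 ∈ X}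

/-- `(s, t, x)` with `(s, t) ∈ [h, T] × [0, T]`, `0 ≤ t ≤ s - h` (in discrete time
`0 ≤ t ≤ s - h - dt`) and `x ∈ X`. -/
def pastSupport {n : ℕ} (τ : TimeModel) (h T : ℝ) (X : Set (State n)) :
    Set (ℝ × ℝ × State n) :=
  {z | z.1 ∈ Icc h T ∧ z.2.1 ∈ Icc 0 T ∧ z.2.1 ∈ Icc 0 (z.1 - h - τ.gap) ∧ z.2.2 ∈ X}

/-- The range `[p_min, p_max]` of `p` on `X`. -/
def valueRange {n : ℕ} (X : Set (State n)) (p : State n → ℝ) : Set ℝ :=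
  Icc (sInf (p '' X)) (sSup (p '' X))

/-- A nonnegative finite Borel measure concentrated on `S`. -/
def FiniteOn {α : Type*} [MeasurableSpace α] (μ : Measure α) (S : Set α) : Prop :=
  IsFiniteMeasure μ ∧ μ Sᶜ = 0

/-- The constraints of the expected-shortfall measure program. -/
structure LPFeasible {n : ℕ} (τ : TimeModel) (h T : ℝ) {X : Set (State n)} (G : Generator T X)
    (X₀ : Set (State n)) (p : State n → ℝ) (ε : ℝ)
    (μ₀ μτ : Measure (ℝ × State n)) (μp μm : Measure (ℝ × ℝ × State n))
    (ν νs : Measure ℝ) : Prop where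
  initial : FiniteOn μ₀ (Icc h T ×ˢ X₀)
  terminal : FiniteOn μτ (Icc h T ×ˢ X)
  window : FiniteOn μp (windowSupport h T X)
  past : FiniteOn μm (pastSupport τ h T X)
  shortfall : FiniteOn ν (valueRange X p)
  slack : FiniteOn νs (valueRange X p)
  flow : ∀ v : ℝ × ℝ × State n → ℝ, G.IsTest h v →
    ∫ z, v (z.1, z.1, z.2) ∂μτ = ∫ z, v (z.1, 0, z.2) ∂μ₀ + ∫ z, G.aug v z ∂(μm + μp)
  initial_mass : μ₀ univ = 1
  window_mass : μp univ = ENNReal.ofReal h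
  shortfall_mass : ν univ = 1
  domination : ENNReal.ofReal ε • ν + νs =
    ((ENNReal.ofReal h)⁻¹ • μp).map (fun z => p z.2.2)

/-- The optimal value `p*_ES` of the expected-shortfall measure program. -/
def lpValue {n : ℕ} (τ : TimeModel) (h T : ℝ) {X : Set (State n)} (G : Generator T X)
    (X₀ : Set (State n)) (p : State n → ℝ) (ε : ℝ) : EReal :=
  sSup {r : EReal | ∃ (μ₀ μτ : Measure (ℝ × State n)) (μp μm : Measure (ℝ × ℝ × State n))
    (ν νs : Measure ℝ), LPFeasible τ h T G X₀ p ε μ₀ μτ μp μm ν νs ∧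
      r = ((∫ q, q ∂ν : ℝ) : EReal)}

end TimeWindowRisk

end

open MeasureTheory ProbabilityTheory Set
open scoped ENNReal

namespace TimeWindowRisk

/-! ### Time domains and their clock measures. -/

namespace TimeModel

/-! Each trajectory is turned into a feasible point of the program with the same objective, so the
inequality follows by taking suprema. The coordinate `s` is frozen at `tstar`: `μ₀` is a Dirac mass,
`μτ` the law of the terminal point, and `μm`, `μp` are the occupation measures before and during the
window. The flow constraint is then the martingale identity between `0` and `tstar` combined with
Fubini (`integral_terminal_eq`).

For `ν`, the window law is cut at an upper `ε`-quantile `l`, splitting the atom there if necessary,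
and its top part is normalised. The same `l` attains the infimum defining the expected shortfall,
with value the mean of `ν` (`exists_top_mass`). -/

theorem mem_times_self {τ : TimeModel} {t T : ℝ} (ht : 0 ≤ t) (h : t ∈ τ.times T) :
    t ∈ τ.times t := by
  cases τ with
  | continuous => exact ⟨ht, le_rfl⟩
  | discrete dt hdt =>
    obtain ⟨k, hk, -⟩ := h
    exact ⟨k, hk, le_rfl⟩

theorem zero_mem_times (τ : TimeModel) {T : ℝ} (hT : 0 ≤ T) : 0 ∈ τ.times T := by
  cases τ with
  | continuous => exact ⟨le_rfl, hT⟩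
  | discrete dt hdt => exact ⟨0, by simp, hT⟩

instance sFinite_clock (τ : TimeModel) : SFinite τ.clock := by
  cases τ <;> unfold clock <;> infer_instance

theorem ae_clock_mem_times (τ : TimeModel) :
    ∀ᵐ t ∂τ.clock, ∀ T, 0 ≤ t → t ≤ T → t ∈ τ.times T := by
  cases τ with
  | continuous => exact Filter.Eventually.of_forall fun t T h0 h1 => ⟨h0, h1⟩
  | discrete dt hdt =>
    refine Measure.ae_smul_measure ?_ _
    rw [Measure.ae_sum_iff]
    intro k
    rw [ae_dirac_eq]
    exact fun T _ h => ⟨k, rfl, h⟩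

/-- On a grid, a half-open interval with both endpoints on the grid contains exactly `(b - a) / dt`
points, each of mass `dt`. -/
theorem clock_Ico {τ : TimeModel} {a b : ℝ} (ha : 0 ≤ a) (hab : a ≤ b) (haτ : a ∈ τ.times b)
    (hbτ : b ∈ τ.times b) : τ.clock (Ico a b) = ENNReal.ofReal (b - a) := by
  cases τ with
  | continuous => simp [clock]
  | discrete dt hdt =>
    obtain ⟨i, rfl, -⟩ := haτ
    obtain ⟨j, rfl, -⟩ := hbτ
    have hij : i ≤ j := by exact_mod_cast le_of_mul_le_mul_right hab hdt
    have hmem (k : ℕ) : (k : ℝ) * dt ∈ Ico ((i : ℝ) * dt) (j * dt) ↔ k ∈ Finset.Ico i j := by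
      simp [mul_le_mul_iff_left₀ hdt, mul_lt_mul_iff_left₀ hdt]
    have hsum : ∑' k : ℕ, Measure.dirac ((k : ℝ) * dt) (Ico ((i : ℝ) * dt) (j * dt))
        = ((j - i : ℕ) : ℝ≥0∞) := by
      rw [tsum_eq_sum (s := Finset.Ico i j)]
      · rw [Finset.sum_congr rfl (g := fun _ => 1)]
        · simp
        · intro k hk
          exact Measure.dirac_apply_of_mem ((hmem k).2 hk)
      · intro k hk
        rw [Measure.dirac_apply' _ measurableSet_Ico, indicator_of_notMem]
        exact fun h => hk ((hmem k).1 h)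
    rw [clock, Measure.smul_apply, Measure.sum_apply _ measurableSet_Ico, hsum, smul_eq_mul,
      ← ENNReal.ofReal_natCast, ← ENNReal.ofReal_mul hdt.le, Nat.cast_sub hij]
    congr 1
    ring

theorem sub_mem_times {τ : TimeModel} {t h T : ℝ} (hτ : τ.Compatible h) (hh : 0 ≤ h)
    (hth : h ≤ t) (ht : t ∈ τ.times T) : t - h ∈ τ.times t := by
  cases τ with
  | continuous => exact ⟨by linarith, by linarith⟩
  | discrete dt hdt =>
    obtain ⟨k, rfl, -⟩ := ht
    obtain ⟨m, rfl⟩ := hτ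
    have hmk : m ≤ k := by exact_mod_cast le_of_mul_le_mul_right hth hdt
    exact ⟨k - m, by rw [Nat.cast_sub hmk]; ring, by linarith⟩

/-- Distinct grid points differ by at least one step. This places the past, which excludes `tstar -
h`, inside `pastSupport`. -/
theorem le_sub_gap {τ : TimeModel} {r t T S : ℝ} (hr : r ∈ τ.times T) (ht : t ∈ τ.times S)
    (hrt : r < t) : r ≤ t - τ.gap := by
  cases τ with
  | continuous => simpa [gap] using hrt.le
  | discrete dt hdt =>
    obtain ⟨i, rfl, -⟩ := hr
    obtain ⟨j, rfl, -⟩ := ht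
    have hij : i + 1 ≤ j := by exact_mod_cast lt_of_mul_lt_mul_right hrt hdt.le
    have : ((i + 1 : ℕ) : ℝ) * dt ≤ j * dt := by gcongr
    push_cast at this
    simp only [gap]
    linarith

end TimeModel

/-! ### Quantiles and expected shortfall. -/

/-- An upper `e`-quantile of a probability measure concentrated on a compact interval. -/
theorem exists_quantile (ξ : Measure ℝ) [IsProbabilityMeasure ξ] {a b : ℝ}
    (hξ : ξ (Icc a b)ᶜ = 0) {e : ℝ≥0∞} (he : e < 1) :
    ∃ l ∈ Icc a b, ξ (Ioi l) ≤ e ∧ e ≤ ξ (Ici l) ∧ ∀ l' < l, e < ξ (Ioi l') := by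
  set S : Set ℝ := {l | ξ (Ioi l) ≤ e} with hS
  have hb : b ∈ S := by
    have : ξ (Ioi b) = 0 := measure_mono_null
      (fun x (hx : b < x) (hx' : x ∈ Icc a b) => not_le.2 hx hx'.2) hξ
    simp [hS, this]
  have hlow : ∀ l ∈ S, a ≤ l := by
    intro l hl
    by_contra! hla
    have h1 : ξ (Ioi l) = 1 := by
      rw [prob_compl_eq_zero_iff measurableSet_Icc] at hξ
      refine le_antisymm prob_le_one (hξ ▸ measure_mono fun x hx => hla.trans_le hx.1)
    exact absurd (h1 ▸ hl : (1 : ℝ≥0∞) ≤ e) (not_le.2 he)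
  have hbdd : BddBelow S := ⟨a, hlow⟩
  have hbelow : ∀ l' < sInf S, e < ξ (Ioi l') := fun l' hl' =>
    not_le.1 fun h => not_le.2 hl' (csInf_le hbdd h)
  -- Continuity of `ξ` from below along `u` bounds the open tail, and from above along `w` the
  -- closed tail.
  obtain ⟨u, huanti, hu, hulim⟩ := exists_seq_strictAnti_tendsto (sInf S)
  obtain ⟨w, hwmono, hw, hwlim⟩ := exists_seq_strictMono_tendsto (sInf S)
  refine ⟨sInf S, ⟨le_csInf ⟨b, hb⟩ hlow, csInf_le hbdd hb⟩, ?_, ?_, hbelow⟩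
  · have hUnion : Ioi (sInf S) = ⋃ k, Ioi (u k) := by
      ext x
      simp only [mem_Ioi, mem_iUnion]
      exact ⟨fun hx => (hulim.eventually_lt_const hx).exists, fun ⟨k, hk⟩ => (hu k).trans hk⟩
    have hdir : Directed (· ⊆ ·) fun k => Ioi (u k) :=
      directed_of_isDirected_le fun i j hij => Ioi_subset_Ioi (huanti.antitone hij)
    rw [hUnion, hdir.measure_iUnion]
    refine iSup_le fun k => ?_
    obtain ⟨l, hl, hlu⟩ := exists_lt_of_csInf_lt ⟨b, hb⟩ (hu k)
    exact (measure_mono (Ioi_subset_Ioi hlu.le)).trans hl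
  · have hInter : Ici (sInf S) = ⋂ k, Ioi (w k) := by
      ext x
      simp only [mem_Ici, mem_iInter, mem_Ioi]
      exact ⟨fun hx k => (hw k).trans_le hx,
        fun hx => le_of_tendsto' hwlim fun k => (hx k).le⟩
    have hanti : Antitone fun k => Ioi (w k) := fun i j hij =>
      Ioi_subset_Ioi (hwmono.monotone hij)
    rw [hInter, hanti.measure_iInter (fun k => measurableSet_Ioi.nullMeasurableSet)
      ⟨0, measure_ne_top _ _⟩]
    exact le_iInf fun k => (hbelow _ (hw k)).le

theorem finiteOn_dirac {l a b : ℝ} (hl : l ∈ Icc a b) : FiniteOn (Measure.dirac l) (Icc a b) :=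
  ⟨inferInstance, by rw [Measure.dirac_apply]; simp [hl]⟩

theorem integrable_id_of_finiteOn {ν : Measure ℝ} {a b : ℝ} (hν : FiniteOn ν (Icc a b)) :
    Integrable (fun q => q) ν := by
  have := hν.1
  exact Integrable.of_mem_Icc a b aemeasurable_id (mem_ae_iff.2 hν.2)

theorem integral_le_add_lintegral {ν : Measure ℝ} {a b : ℝ} (hν : FiniteOn ν (Icc a b))
    (h1 : ν univ = 1) (l : ℝ) :
    ((∫ q, q ∂ν : ℝ) : EReal) ≤
      (l : EReal) + ((∫⁻ q, ENNReal.ofReal (q - l) ∂ν : ℝ≥0∞) : EReal) := by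
  have : IsProbabilityMeasure ν := ⟨h1⟩
  have hint : Integrable (fun q => q - l) ν :=
    (integrable_id_of_finiteOn hν).sub (integrable_const l)
  have hfin : ∫⁻ q, ENNReal.ofReal (q - l) ∂ν ≠ ∞ := hint.lintegral_lt_top.ne
  rw [← EReal.coe_ennreal_toReal hfin, ← EReal.coe_add, EReal.coe_le_coe_iff]
  have h := integral_eq_lintegral_pos_part_sub_lintegral_neg_part hint
  rw [integral_sub (integrable_id_of_finiteOn hν) (integrable_const l)] at h
  simp only [integral_const, probReal_univ, one_smul] at h
  linarith [ENNReal.toReal_nonneg (a := ∫⁻ q, ENNReal.ofReal (-(q - l)) ∂ν)]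

theorem add_lintegral_eq_integral {ν : Measure ℝ} {a b : ℝ} (hν : FiniteOn ν (Icc a b))
    (h1 : ν univ = 1) {l : ℝ} (hl : ∀ᵐ q ∂ν, l ≤ q) :
    (l : EReal) + ((∫⁻ q, ENNReal.ofReal (q - l) ∂ν : ℝ≥0∞) : EReal) =
      ((∫ q, q ∂ν : ℝ) : EReal) := by
  have : IsProbabilityMeasure ν := ⟨h1⟩
  have hint : Integrable (fun q => q - l) ν :=
    (integrable_id_of_finiteOn hν).sub (integrable_const l)
  have hnn : 0 ≤ᵐ[ν] fun q => q - l := hl.mono fun q hq => sub_nonneg.2 hq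
  rw [← ofReal_integral_eq_lintegral_ofReal hint hnn,
    EReal.coe_ennreal_ofReal, max_eq_left (integral_nonneg_of_ae hnn),
    integral_sub (integrable_id_of_finiteOn hν) (integrable_const l), ← EReal.coe_add]
  simp

/-- The normalised top-`ε` mass of `ξ` has the expected shortfall of `ξ` as its mean. -/
theorem exists_top_mass (ξ : Measure ℝ) [IsProbabilityMeasure ξ] {a b : ℝ}
    (hξ : ξ (Icc a b)ᶜ = 0) {ε : ℝ} (hε : ε ∈ Ico (0 : ℝ) 1) :
    ∃ ν νs : Measure ℝ, FiniteOn ν (Icc a b) ∧ FiniteOn νs (Icc a b) ∧ ν univ = 1 ∧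
      ENNReal.ofReal ε • ν + νs = ξ ∧ ((∫ q, q ∂ν : ℝ) : EReal) = expectedShortfall ε ξ := by
  set e := ENNReal.ofReal ε with he
  have he1 : e < 1 := ENNReal.ofReal_lt_one.2 hε.2
  have hetop : e ≠ ∞ := ENNReal.ofReal_ne_top
  obtain ⟨l, hl, hgt, hge, hlt⟩ := exists_quantile ξ hξ he1
  rcases eq_or_ne e 0 with he0 | he0
  -- For `ε = 0` the domination constraint leaves `ν` free: the slack is all of `ξ`, and `ν` sits at
  -- the essential supremum `l`.
  · refine ⟨Measure.dirac l, ξ, finiteOn_dirac hl, ⟨inferInstance, hξ⟩, by simp,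
      by simp [he0], ?_⟩
    rw [integral_dirac]
    refine le_antisymm (le_iInf fun l' => ?_) (iInf_le_of_le l ?_)
    · rcases le_or_gt l l' with h | h
      · exact (EReal.coe_le_coe_iff.2 h).trans
          (le_add_of_nonneg_right (EReal.coe_ennreal_nonneg _))
      -- Below `l` the tail has positive mass, so the factor `∞` makes the penalty infinite.
      · have hne : ∫⁻ q, ENNReal.ofReal (q - l') ∂ξ ≠ 0 := by
          rw [← pos_iff_ne_zero, lintegral_pos_iff_support (by fun_prop)]
          refine (pos_of_gt (hlt l' h)).trans_le (measure_mono fun q hq => ?_)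
          simpa using hq
        rw [← he, he0, ENNReal.inv_zero, ENNReal.top_mul hne]
        simp
    · have hz : ∫⁻ q, ENNReal.ofReal (q - l) ∂ξ = 0 := by
        rw [lintegral_eq_zero_iff (by fun_prop)]
        have : ξ (Ioi l) = 0 := le_antisymm (he0 ▸ hgt) bot_le
        refine measure_mono_null (fun q hq => ?_) this
        simpa using hq
      simp [hz]
  -- `c` is the share of the atom at `l` that raises the mass of the open tail to exactly `e`.
  · set c := e - ξ (Ioi l) with hc
    have hce : ξ (Ioi l) + c = e := add_tsub_cancel_of_le hgt
    have hcl : c ≤ ξ {l} := by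
      rw [hc, tsub_le_iff_left]
      refine hge.trans ?_
      rw [← Ioi_insert, insert_eq, add_comm]
      exact measure_union_le _ _
    set ρ := ξ.restrict (Ioi l) + c • Measure.dirac l with hρ
    set νs := ξ.restrict (Iio l) + (ξ {l} - c) • Measure.dirac l with hνs
    have hsum : ρ + νs = ξ := by
      have h1 : c • Measure.dirac l + (ξ {l} - c) • Measure.dirac l = ξ.restrict {l} := by
        rw [← add_smul, add_tsub_cancel_of_le hcl, Measure.restrict_singleton]
      have h2 : ξ.restrict {l} + ξ.restrict (Ioi l) = ξ.restrict (Ici l) := by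
        rw [← Measure.restrict_union (by simp) measurableSet_Ioi, ← insert_eq, Ioi_insert]
      calc ρ + νs = (c • Measure.dirac l + (ξ {l} - c) • Measure.dirac l + ξ.restrict (Ioi l))
            + ξ.restrict (Iio l) := by rw [hρ, hνs]; abel
        _ = ξ := by
          rw [h1, h2, ← compl_Ici, Measure.restrict_add_restrict_compl measurableSet_Ici]
    have hρξ : ρ ≤ ξ := hsum ▸ Measure.le_add_right le_rfl
    have hνsξ : νs ≤ ξ := hsum ▸ Measure.le_add_left le_rfl
    have hscale : e • e⁻¹ • ρ = ρ := by
      rw [smul_smul, ENNReal.mul_inv_cancel he0 hetop, one_smul]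
    have hν : FiniteOn (e⁻¹ • ρ) (Icc a b) := by
      have : IsFiniteMeasure ρ := isFiniteMeasure_of_le ξ hρξ
      refine ⟨Measure.smul_finite ρ (ENNReal.inv_ne_top.2 he0), ?_⟩
      rw [Measure.smul_apply, le_antisymm ((hρξ _).trans hξ.le) bot_le, smul_zero]
    have hν1 : (e⁻¹ • ρ) univ = 1 := by
      have hρ1 : ρ univ = e := by simp [hρ, hce]
      rw [Measure.smul_apply, hρ1, smul_eq_mul, ENNReal.inv_mul_cancel he0 hetop]
    refine ⟨e⁻¹ • ρ, νs, hν, ⟨isFiniteMeasure_of_le ξ hνsξ,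
      le_antisymm ((hνsξ _).trans hξ.le) bot_le⟩, hν1, by rw [hscale, hsum], ?_⟩
    refine le_antisymm (le_iInf fun l' => ?_) (iInf_le_of_le l ?_)
    -- Any `l'` gives an upper bound for the mean of `ν`, and `ρ ≤ ξ` only increases the penalty.
    · refine (integral_le_add_lintegral hν hν1 l').trans ?_
      rw [lintegral_smul_measure, smul_eq_mul]
      gcongr
      exact EReal.coe_ennreal_le_coe_ennreal_iff.2
        (mul_le_mul_right (lintegral_mono' hρξ le_rfl) _)
    -- Equality at `l`: `ν` lives on `[l, ∞)`, where the positive part is exact, and `νs` on `(-∞,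
    -- l]`, where it vanishes.
    · have hae : ∀ᵐ q ∂(e⁻¹ • ρ), l ≤ q := by
        refine Measure.ae_smul_measure ?_ _
        rw [hρ, ae_add_measure_iff]
        refine ⟨(ae_restrict_mem measurableSet_Ioi).mono fun q hq => le_of_lt hq,
          Measure.ae_smul_measure ?_ _⟩
        rw [ae_dirac_eq]
        exact le_refl l
      have hz : ∫⁻ q, ENNReal.ofReal (q - l) ∂νs = 0 := by
        rw [hνs, lintegral_add_measure, lintegral_smul_measure, lintegral_dirac,
          setLIntegral_congr_fun (g := fun _ => 0) measurableSet_Iio]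
        · simp
        · exact fun q hq => ENNReal.ofReal_of_nonpos (sub_nonpos.2 (le_of_lt hq))
      rw [← add_lintegral_eq_integral hν hν1 hae, lintegral_smul_measure, smul_eq_mul, ← he,
        ← hsum, lintegral_add_measure, hz, add_zero]

/-! ### Occupation measures and the flow constraint. -/

namespace Trajectory

variable {n : ℕ} {τ : TimeModel} {h T : ℝ} {X : Set (State n)} {G : Generator T X}
  {X₀ : Set (State n)}

/-- The occupation measure of `(tstar, t, x t)` over the times in `I`. -/
noncomputable def occ (A : Trajectory τ h T G X₀) (I : Set ℝ) : Measure (ℝ × ℝ × State n) :=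
  ((τ.clock.restrict I).prod A.P).map (fun z => (A.tstar, z.1, A.path z.1 z.2))

theorem measurable_lift (A : Trajectory τ h T G X₀) :
    Measurable fun z : ℝ × A.Ω => (A.tstar, z.1, A.path z.1 z.2) :=
  measurable_const.prodMk (measurable_fst.prodMk A.measurable_path)

theorem measurable_path_apply (A : Trajectory τ h T G X₀) (t : ℝ) : Measurable (A.path t) :=
  A.measurable_path.comp measurable_prodMk_left

/-- The path is constrained to `X` only at times of the time domain; the clock charges no others. -/
theorem ae_prod_mem (A : Trajectory τ h T G X₀) {a b : ℝ} (ha : 0 ≤ a) (hb : b ≤ A.tstar) :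
    ∀ᵐ z ∂((τ.clock.restrict (Ico a b)).prod A.P),
      z.1 ∈ Ico a b ∧ z.1 ∈ τ.times A.tstar ∧ A.path z.1 z.2 ∈ X := by
  have h1 : ∀ᵐ t ∂τ.clock.restrict (Ico a b), t ∈ Ico a b ∧ t ∈ τ.times A.tstar := by
    filter_upwards [ae_restrict_mem measurableSet_Ico, ae_restrict_of_ae τ.ae_clock_mem_times]
      with t ht hτ
    exact ⟨ht, hτ _ (ha.trans ht.1) (ht.2.le.trans hb)⟩
  filter_upwards [Measure.quasiMeasurePreserving_fst.ae h1] with z hz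
  exact ⟨hz.1, hz.2, A.mem_state _ hz.2 _⟩

theorem measurable_op_snd (w : G.op.domain) :
    Measurable fun z : ℝ × ℝ × State n => G.op w z.2 :=
  (G.measurable_op w).comp measurable_snd

theorem measurable_value {p : State n → ℝ} (hp : Measurable p) :
    Measurable fun z : ℝ × ℝ × State n => p z.2.2 :=
  hp.comp measurable_snd.snd

theorem occ_compl_eq_zero (A : Trajectory τ h T G X₀) {a b : ℝ} (ha : 0 ≤ a) (hb : b ≤ A.tstar)
    {S : Set (ℝ × ℝ × State n)} (hS : MeasurableSet S)
    (hmem : ∀ t ∈ Ico a b, t ∈ τ.times A.tstar → ∀ x ∈ X, (A.tstar, t, x) ∈ S) :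
    A.occ (Ico a b) Sᶜ = 0 := by
  rw [← mem_ae_iff, occ]
  refine (ae_map_iff A.measurable_lift.aemeasurable hS).2 ?_
  filter_upwards [A.ae_prod_mem ha hb] with z hz
  exact hmem _ hz.1 hz.2.1 _ hz.2.2

theorem occ_univ (A : Trajectory τ h T G X₀) (I : Set ℝ) : A.occ I univ = τ.clock I := by
  rw [occ, Measure.map_apply A.measurable_lift MeasurableSet.univ, preimage_univ,
    ← univ_prod_univ, Measure.prod_prod]
  simp

theorem occ_add_occ (A : Trajectory τ h T G X₀) {a b c : ℝ} (hab : a ≤ b) (hbc : b ≤ c) :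
    A.occ (Ico a b) + A.occ (Ico b c) = A.occ (Ico a c) := by
  rw [occ, occ, occ, ← Measure.map_add _ _ A.measurable_lift, ← Measure.add_prod,
    ← Measure.restrict_union (by simp) measurableSet_Ico, Ico_union_Ico_eq_Ico hab hbc]

/-- The expected increment of `w` along a trajectory is the pairing of `L w` with the occupation
measure. -/
theorem integral_terminal_eq (A : Trajectory τ h T G X₀) (hh : 0 ≤ h) (w : G.op.domain) :
    ∫ ω, (w : ℝ × State n → ℝ) (A.tstar, A.path A.tstar ω) ∂A.P
      = (w : ℝ × State n → ℝ) (0, A.x0) + ∫ z, G.op w z.2 ∂A.occ (Ico 0 A.tstar) := by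
  have ht0 : 0 ≤ A.tstar := hh.trans A.tstar_mem_Icc.1
  have hend : A.tstar ∈ τ.times A.tstar := TimeModel.mem_times_self ht0 A.tstar_mem_times
  have h0 : (0 : ℝ) ∈ τ.times A.tstar := τ.zero_mem_times ht0
  have hclock : τ.clock (Ico 0 A.tstar) ≠ ∞ := by
    rw [TimeModel.clock_Ico le_rfl ht0 h0 hend]
    exact ENNReal.ofReal_ne_top
  have : IsFiniteMeasure (τ.clock.restrict (Ico 0 A.tstar)) :=
    isFiniteMeasure_restrict.2 hclock
  have hlift : Measurable fun z : ℝ × A.Ω => (z.1, A.path z.1 z.2) :=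
    measurable_fst.prodMk A.measurable_path
  have hmeas : Measurable fun z : ℝ × A.Ω => G.op w (z.1, A.path z.1 z.2) :=
    (G.measurable_op w).comp hlift
  have hintL : Integrable (fun z : ℝ × A.Ω => G.op w (z.1, A.path z.1 z.2))
      ((τ.clock.restrict (Ico 0 A.tstar)).prod A.P) := by
    obtain ⟨M, hM⟩ := G.bounded_op w
    refine Integrable.of_bound hmeas.aestronglyMeasurable M ?_
    filter_upwards [A.ae_prod_mem le_rfl le_rfl] with z hz
    exact hM _ ⟨⟨hz.1.1, hz.1.2.le.trans A.tstar_mem_Icc.2⟩, hz.2.2⟩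
  have hintw : Integrable
      (fun ω => (w : ℝ × State n → ℝ) (A.tstar, A.path A.tstar ω)) A.P := by
    obtain ⟨M, hM⟩ := G.bounded_dom w
    refine Integrable.of_bound ((G.measurable_dom w).comp
      (measurable_const.prodMk (A.measurable_path_apply _))).aestronglyMeasurable M
      (Filter.Eventually.of_forall fun ω => ?_)
    exact hM _ ⟨⟨ht0, A.tstar_mem_Icc.2⟩, A.mem_state _ hend _⟩
  -- At time `0` the compensator is an integral over the empty interval and the state is the
  -- constant `x0`.
  have hmart := (A.follows w).setIntegral_eq (i := ⟨0, h0⟩) (j := ⟨A.tstar, hend⟩) ht0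
    MeasurableSet.univ
  simp only [Measure.restrict_univ, A.start, Ico_self, Measure.restrict_empty,
    integral_zero_measure, sub_zero, integral_const, probReal_univ, one_smul] at hmart
  rw [integral_sub hintw hintL.integral_prod_right, ← integral_prod_symm _ hintL] at hmart
  have hocc : ∫ z, G.op w z.2 ∂A.occ (Ico 0 A.tstar)
      = ∫ z : ℝ × A.Ω, G.op w (z.1, A.path z.1 z.2)
        ∂((τ.clock.restrict (Ico 0 A.tstar)).prod A.P) := by
    rw [occ, integral_map A.measurable_lift.aemeasurable
      (measurable_op_snd w).aestronglyMeasurable]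
  rw [hocc]
  linarith

/-- The initial, terminal, past and window measures of a trajectory satisfy the flow constraint. -/
theorem flow (A : Trajectory τ h T G X₀) (hh : 0 ≤ h) {v : ℝ × ℝ × State n → ℝ}
    (hv : G.IsTest h v) :
    ∫ z, v (z.1, z.1, z.2) ∂A.P.map (fun ω => (A.tstar, A.path A.tstar ω))
      = ∫ z, v (z.1, 0, z.2) ∂Measure.dirac (A.tstar, A.x0)
        + ∫ z, G.aug v z ∂A.occ (Ico 0 A.tstar) := by
  have hslice := hv.slice _ A.tstar_mem_Icc
  -- Only the slice `s = tstar` is charged; it lies in the domain of `L`, so the default value of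
  -- `app` does not occur.
  have haug : ∀ y, G.aug v (A.tstar, y) = G.op ⟨_, hslice⟩ y := fun y => by
    simp [Generator.aug, Generator.app, hslice]
  have hocc : ∫ z, G.aug v z ∂A.occ (Ico 0 A.tstar)
      = ∫ z, G.op ⟨_, hslice⟩ z.2 ∂A.occ (Ico 0 A.tstar) := by
    rw [occ, integral_map A.measurable_lift.aemeasurable hv.measurable_aug.aestronglyMeasurable,
      integral_map A.measurable_lift.aemeasurable
        (measurable_op_snd _).aestronglyMeasurable]
    simp only [haug]
  have hmeas : Measurable fun z : ℝ × State n => v (z.1, z.1, z.2) :=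
    hv.measurable.comp (measurable_fst.prodMk measurable_id)
  rw [integral_map (measurable_const.prodMk (A.measurable_path_apply _)).aemeasurable
    hmeas.aestronglyMeasurable, integral_dirac, hocc]
  exact A.integral_terminal_eq hh ⟨_, hslice⟩

/-! ### Feasibility of the measures built from a trajectory. -/

theorem windowLaw_eq_map (A : Trajectory τ h T G X₀) {p : State n → ℝ} (hp : Measurable p) :
    A.windowLaw p = ((ENNReal.ofReal h)⁻¹ • A.windowOcc).map (fun z => p z.2.2) := by
  rw [windowLaw, windowOcc, Measure.map_smul, Measure.map_smul,
    Measure.map_map (measurable_value hp) A.measurable_lift]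
  rfl

theorem windowOcc_univ (A : Trajectory τ h T G X₀) (hh : 0 ≤ h) (hτ : τ.Compatible h) :
    A.windowOcc univ = ENNReal.ofReal h := by
  have ht := A.tstar_mem_Icc.1
  refine (A.occ_univ _).trans ?_
  rw [TimeModel.clock_Ico (sub_nonneg.2 ht) (by linarith)
    (TimeModel.sub_mem_times hτ hh ht A.tstar_mem_times)
    (TimeModel.mem_times_self (hh.trans ht) A.tstar_mem_times), sub_sub_cancel]

theorem finiteOn_windowOcc (A : Trajectory τ h T G X₀) (hh : 0 ≤ h) (hτ : τ.Compatible h)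
    (hX : MeasurableSet X) : FiniteOn A.windowOcc (windowSupport h T X) := by
  refine ⟨⟨by rw [A.windowOcc_univ hh hτ]; exact ENNReal.ofReal_lt_top⟩,
    A.occ_compl_eq_zero (sub_nonneg.2 A.tstar_mem_Icc.1) le_rfl ?_ fun t ht _ x hx =>
      ⟨A.tstar_mem_Icc, ⟨(sub_nonneg.2 A.tstar_mem_Icc.1).trans ht.1,
        ht.2.le.trans A.tstar_mem_Icc.2⟩, ⟨ht.1, ht.2.le⟩, hx⟩⟩
  refine (measurable_fst measurableSet_Icc).inter
    ((measurable_snd.fst measurableSet_Icc).inter (MeasurableSet.inter ?_ (measurable_snd.snd hX)))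
  exact (measurableSet_le (measurable_fst.sub_const h) measurable_snd.fst).inter
    (measurableSet_le measurable_snd.fst measurable_fst)

theorem finiteOn_past (A : Trajectory τ h T G X₀) (hh : 0 ≤ h) (hτ : τ.Compatible h)
    (hX : MeasurableSet X) :
    FiniteOn (A.occ (Ico 0 (A.tstar - h))) (pastSupport τ h T X) := by
  have ht := A.tstar_mem_Icc.1
  have hsub := TimeModel.sub_mem_times hτ hh ht A.tstar_mem_times
  have h0 := sub_nonneg.2 ht
  refine ⟨⟨?_⟩, A.occ_compl_eq_zero le_rfl (sub_le_self _ hh) ?_ fun t ht htimes x hx =>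
      ⟨A.tstar_mem_Icc, ⟨ht.1, (ht.2.le.trans (sub_le_self _ hh)).trans A.tstar_mem_Icc.2⟩,
        ⟨ht.1, TimeModel.le_sub_gap htimes hsub ht.2⟩, hx⟩⟩
  · rw [occ_univ, TimeModel.clock_Ico le_rfl h0 (τ.zero_mem_times h0)
      (TimeModel.mem_times_self h0 hsub)]
    exact ENNReal.ofReal_lt_top
  · refine (measurable_fst measurableSet_Icc).inter ((measurable_snd.fst measurableSet_Icc).inter
      (MeasurableSet.inter ?_ (measurable_snd.snd hX)))
    exact (measurableSet_le measurable_const measurable_snd.fst).inter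
      (measurableSet_le measurable_snd.fst ((measurable_fst.sub_const h).sub_const τ.gap))

theorem isProbabilityMeasure_windowLaw (A : Trajectory τ h T G X₀) (hh : 0 < h)
    (hτ : τ.Compatible h) {p : State n → ℝ} (hp : Measurable p) :
    IsProbabilityMeasure (A.windowLaw p) := by
  refine ⟨?_⟩
  rw [A.windowLaw_eq_map hp, Measure.map_apply (measurable_value hp) MeasurableSet.univ,
    preimage_univ, Measure.smul_apply, A.windowOcc_univ hh.le hτ, smul_eq_mul,
    ENNReal.inv_mul_cancel (by simpa using hh) ENNReal.ofReal_ne_top]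

theorem windowLaw_compl_valueRange (A : Trajectory τ h T G X₀) (hh : 0 ≤ h)
    (hτ : τ.Compatible h) (hX : MeasurableSet X) {p : State n → ℝ} (hp : Measurable p)
    (hp_below : BddBelow (p '' X)) (hp_above : BddAbove (p '' X)) :
    A.windowLaw p (valueRange X p)ᶜ = 0 := by
  rw [A.windowLaw_eq_map hp,
    Measure.map_apply (measurable_value hp) (by exact measurableSet_Icc.compl),
    Measure.smul_apply,
    measure_mono_null _ (A.finiteOn_windowOcc hh hτ hX).2, smul_zero]
  exact fun z hz hz' => hz ⟨csInf_le hp_below ⟨_, hz'.2.2.2, rfl⟩,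
    le_csSup hp_above ⟨_, hz'.2.2.2, rfl⟩⟩

theorem exists_lpFeasible (A : Trajectory τ h T G X₀) (hh : 0 < h) (hτ : τ.Compatible h)
    (hX : MeasurableSet X) {p : State n → ℝ} (hp : Measurable p)
    (hp_below : BddBelow (p '' X)) (hp_above : BddAbove (p '' X)) {ε : ℝ}
    (hε : ε ∈ Ico (0 : ℝ) 1) :
    ∃ (μ₀ μτ : Measure (ℝ × State n)) (μm : Measure (ℝ × ℝ × State n)) (ν νs : Measure ℝ),
      LPFeasible τ h T G X₀ p ε μ₀ μτ A.windowOcc μm ν νs ∧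
      ((∫ q, q ∂ν : ℝ) : EReal) = expectedShortfall ε (A.windowLaw p) := by
  have := A.isProbabilityMeasure_windowLaw hh hτ hp
  obtain ⟨ν, νs, hν, hνs, hν1, hdom, hES⟩ := exists_top_mass (A.windowLaw p)
    (A.windowLaw_compl_valueRange hh.le hτ hX hp hp_below hp_above) hε
  have ht := A.tstar_mem_Icc.1
  have hend : A.tstar ∈ τ.times A.tstar :=
    TimeModel.mem_times_self (hh.le.trans ht) A.tstar_mem_times
  have hlast : Measurable fun ω => (A.tstar, A.path A.tstar ω) :=
    measurable_const.prodMk (A.measurable_path_apply _)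
  refine ⟨Measure.dirac (A.tstar, A.x0), A.P.map fun ω => (A.tstar, A.path A.tstar ω),
    A.occ (Ico 0 (A.tstar - h)), ν, νs, ?_, hES⟩
  exact
    { initial := ⟨inferInstance, by
        -- `X₀` need not be Borel; measurability of singletons suffices to evaluate the Dirac mass.
        rw [Measure.dirac_apply, indicator_of_notMem]
        exact not_not.2 ⟨A.tstar_mem_Icc, A.x0_mem⟩⟩
      terminal := ⟨Measure.isFiniteMeasure_map _ _, by
        rw [Measure.map_apply hlast (measurableSet_Icc.prod hX).compl]
        convert measure_empty (μ := A.P)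
        exact eq_empty_of_forall_notMem fun ω hω =>
          hω ⟨A.tstar_mem_Icc, A.mem_state _ hend ω⟩⟩
      window := A.finiteOn_windowOcc hh.le hτ hX
      past := A.finiteOn_past hh.le hτ hX
      shortfall := hν
      slack := hνs
      flow := fun v hv => by
        have hocc : A.occ (Ico 0 (A.tstar - h)) + A.windowOcc = A.occ (Ico 0 A.tstar) :=
          A.occ_add_occ (sub_nonneg.2 ht) (sub_le_self _ hh.le)
        rw [hocc]
        exact A.flow hh.le hv
      initial_mass := by simp
      window_mass := A.windowOcc_univ hh.le hτ
      shortfall_mass := hν1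
      domination := by rw [hdom, A.windowLaw_eq_map hp] }

end Trajectory

end TimeWindowRisk

theorem mainTheorem7 {n : ℕ} (τ : TimeWindowRisk.TimeModel) (h T : ℝ) (hh : 0 < h) (hT : h ≤ T)
    (hτ : τ.Compatible h) (X X₀ : Set (TimeWindowRisk.State n)) (hX : MeasurableSet X)
    (hX₀ : X₀ ⊆ X) (G : TimeWindowRisk.Generator T X) (p : TimeWindowRisk.State n → ℝ)
    (hp : Measurable p) (hp_below : BddBelow (p '' X)) (hp_above : BddAbove (p '' X))
    (ε : ℝ) (hε : ε ∈ Set.Ico (0 : ℝ) 1) :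
    TimeWindowRisk.riskValue τ h T G X₀ p ε ≤ TimeWindowRisk.lpValue τ h T G X₀ p ε ∧
    ∀ A : TimeWindowRisk.Trajectory τ h T G X₀,
      ∃ (μ₀ μτ : MeasureTheory.Measure (ℝ × TimeWindowRisk.State n))
        (μm : MeasureTheory.Measure (ℝ × ℝ × TimeWindowRisk.State n))
        (ν νs : MeasureTheory.Measure ℝ),
        TimeWindowRisk.LPFeasible τ h T G X₀ p ε μ₀ μτ A.windowOcc μm ν νs ∧
        ((∫ q, q ∂ν : ℝ) : EReal) =
          TimeWindowRisk.expectedShortfall ε (A.windowLaw p) := by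
  have key := fun A : TimeWindowRisk.Trajectory τ h T G X₀ =>
    A.exists_lpFeasible hh hτ hX hp hp_below hp_above hε
  refine ⟨iSup_le fun A => ?_, key⟩
  obtain ⟨μ₀, μτ, μm, ν, νs, hfeas, hES⟩ := key A
  exact le_sSup ⟨μ₀, μτ, A.windowOcc, μm, ν, νs, hfeas, hES.symm⟩
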